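/- Let $\mathrm{Var}$ be a countable set of sentential variables with three fixed distinct members $p,q,r$, and consider formulas built from $\mathrm{Var}$ with the connectives $\wedge,\vee,\rightarrow,\neg$ and the unary modality $\square$. A formula is \emph{assertoric} if $\square$ does not occur in it. Consider the following groups of axioms: (i) $p\rightarrow(q\rightarrow p)$, $\ (p\rightarrow(q\rightarrow r))\rightarrow((p\rightarrow q)\rightarrow(p\rightarrow r))$; (c) $(p\wedge q)\rightarrow p$, $\ (p\wedge q)\rightarrow q$, $\ p\rightarrow(q\rightarrow(p\wedge q))$; (d) $p\rightarrow(p\vee q)$, $\ p\rightarrow(q\vee p)$, $\ (p\rightarrow r)\rightarrow((q\rightarrow r)\rightarrow((p\vee q)\rightarrow r))$; (n) $(p\rightarrow q)\rightarrow((p\rightarrow\neg q)\rightarrow\neg p)$, $\ p\rightarrow(\neg p\rightarrow q)$; (m) $\square(p\rightarrow q)\rightarrow(\square p\rightarrow\square q)$, $\ p\rightarrow\square p$, $\ \square p\rightarrow(((q\rightarrow p)\rightarrow q)\rightarrow q)$. The calculus $\mathbf{E}$ has the axioms of all five groups; its inference rules are modus ponens and uniform substitution of formulas for variables. The groups (c),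 (d), (n) correspond to the connectives $\wedge$, $\vee$, $\neg$, respectively. \textbf{Corollary (limited separation property for $\mathbf{E}$).} Let $A$ be an assertoric formula. Then $A$ is derivable in $\mathbf{E}$ if and only if $A$ is derivable, by the same inference rules, using only the axioms of group (i) and of those among the groups (c), (d), (n) which correspond to connectives that actually occur in $A$. -/

import Mathlib

/-- The connectives of the modal language. -/
inductive Connective : Type
  | conj | disj | imp | neg | box

/-- Formulas of the modal language `𝔏ₘ` over the set `Var` of sentential variables. -/
inductive Form (Var : Type*) : Type _
  | var (x : Var) : Form Var
  | conj (α β : Form Var) : Form Var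
  | disj (α β : Form Var) : Form Var
  | imp (α β : Form Var) : Form Var
  | neg (α : Form Var) : Form Var
  | box (α : Form Var) : Form Var

infixr:60 " ⇒ " => Form.imp
infixl:70 " ⋏ " => Form.conj
infixl:65 " ⋎ " => Form.disj
prefix:80 "∼" => Form.neg
prefix:80 "□" => Form.box

namespace Form

/-- The set of connectives actually appearing in a formula. -/
def connectives {Var : Type*} : Form Var → Set Connective
  | var _ => ∅
  | conj α β => {Connective.conj} ∪ (α.connectives ∪ β.connectives)
  | disj α β => {Connective.disj} ∪ (α.connectives ∪ β.connectives)
  | imp α β => {Connective.imp} ∪ (α.connectives ∪ β.connectives)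
  | neg α => {Connective.neg} ∪ α.connectives
  | box α => {Connective.box} ∪ α.connectives

/-- Assertoric formulas are the `□`-free ones. -/
def IsAssertoric {Var : Type*} (α : Form Var) : Prop :=
  Connective.box ∉ α.connectives

/-- Uniform substitution: the endomorphism of the formula algebra extending `s`. -/
def subst {Var : Type*} (s : Var → Form Var) : Form Var → Form Var
  | var x => s x
  | conj α β => conj (α.subst s) (β.subst s)
  | disj α β => disj (α.subst s) (β.subst s)
  | imp α β => imp (α.subst s) (β.subst s)
  | neg α => neg (α.subst s)
  | box α => box (α.subst s)

end Form

/-- The names of the five groups of axioms. -/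
inductive AxiomGroup : Type
  | i | c | d | n | m

/-- The axioms in each group, where `p`, `q`, `r` stand for three fixed variables. -/
def AxiomGroup.formulas {Var : Type*} (p q r : Form Var) : AxiomGroup → Set (Form Var)
  | i => {p ⇒ (q ⇒ p),
          (p ⇒ (q ⇒ r)) ⇒ ((p ⇒ q) ⇒ (p ⇒ r))}
  | c => {(p ⋏ q) ⇒ p,
          (p ⋏ q) ⇒ q,
          p ⇒ (q ⇒ (p ⋏ q))}
  | d => {p ⇒ (p ⋎ q),
          p ⇒ (q ⋎ p),
          (p ⇒ r) ⇒ ((q ⇒ r) ⇒ ((p ⋎ q) ⇒ r))}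
  | n => {(p ⇒ q) ⇒ ((p ⇒ ∼q) ⇒ ∼p),
          p ⇒ (∼p ⇒ q)}
  | m => {□(p ⇒ q) ⇒ (□p ⇒ □q),
          p ⇒ □p,
          □p ⇒ (((q ⇒ p) ⇒ q) ⇒ q)}

/-- The group of axioms corresponding to a connective. -/
def Connective.group : Connective → AxiomGroup
  | conj => .c
  | disj => .d
  | imp => .i
  | neg => .n
  | box => .m

/-- The axioms of all groups belonging to `G`, written in the variables `p`, `q`, `r`. -/
def axiomsOf {Var : Type*} (p q r : Var) (G : Set AxiomGroup) : Set (Form Var) :=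
  {α | ∃ g ∈ G, α ∈ g.formulas (Form.var p) (Form.var q) (Form.var r)}

/-- Derivability from a set of axioms by modus ponens and uniform substitution. -/
inductive Derivable {Var : Type*} (Ax : Set (Form Var)) : Form Var → Prop
  | ax {α : Form Var} : α ∈ Ax → Derivable Ax α
  | mp {α β : Form Var} : Derivable Ax (α ⇒ β) → Derivable Ax α → Derivable Ax β
  | sub {α : Form Var} (s : Var → Form Var) : Derivable Ax α → Derivable Ax (α.subst s)

/-- Derivability in the calculus `E`, whose axioms are those of all the groups (i), (c), (d),
(n), (m). -/
def DerivableE {Var : Type*} (p q r : Var) (α : Form Var) : Prop :=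
  Derivable (axiomsOf p q r Set.univ) α

/-- Group (i) together with the groups that correspond to the connectives appearing in `α`. -/
def relevantGroups {Var : Type*} (α : Form Var) : Set AxiomGroup :=
  {AxiomGroup.i} ∪ Connective.group '' α.connectives

/-! ### Kripke semantics with a strict modality -/

namespace Form

/-! `E` is sound for every partially ordered Kripke model, with `□` read over strict successors. The
fragment matching `A` is complete for `A`: its relatively maximal theories, ordered by inclusion,
form a canonical model (`forces_canonical_iff`). That model is a partial order, so it interprets `□`
for free, and a formula it refutes is underivable in `E` too. Maximality is relative to an omitted
formula, since without negation consistency is not expressible. -/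

/-- Intuitionistic Kripke forcing over a preorder, `□` referring to the strict successors. -/
def Forces {Var W : Type*} [Preorder W] (V : Var → Set W) : W → Form Var → Prop
  | w, var x => w ∈ V x
  | w, conj α β => Forces V w α ∧ Forces V w β
  | w, disj α β => Forces V w α ∨ Forces V w β
  | w, imp α β => ∀ v, w ≤ v → Forces V v α → Forces V v β
  | w, neg α => ∀ v, w ≤ v → ¬ Forces V v α
  | w, box α => ∀ v, w < v → Forces V v α

theorem Forces.mono {Var W : Type*} [Preorder W] {V : Var → Set W} (hV : ∀ x, IsUpperSet (V x))
    {α : Form Var} {w v : W} (hwv : w ≤ v) (h : Forces V w α) : Forces V v α := by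
  induction α with
  | var x => exact hV x hwv h
  | conj α β ihα ihβ => exact ⟨ihα h.1, ihβ h.2⟩
  | disj α β ihα ihβ => exact h.imp ihα ihβ
  | imp α β _ _ => exact fun u hu => h u (hwv.trans hu)
  | neg α _ => exact fun u hu => h u (hwv.trans hu)
  | box α _ => exact fun u hu => h u (hwv.trans_lt hu)

theorem forces_subst {Var W : Type*} [Preorder W] (V : Var → Set W) (s : Var → Form Var)
    (α : Form Var) (w : W) :
    Forces V w (α.subst s) ↔ Forces (fun x => {v | Forces V v (s x)}) w α := by
  induction α generalizing w with
  | var x => rfl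
  | conj α β ihα ihβ => simp only [subst, Forces, ihα, ihβ]
  | disj α β ihα ihβ => simp only [subst, Forces, ihα, ihβ]
  | imp α β ihα ihβ => simp only [subst, Forces, ihα, ihβ]
  | neg α ih => simp only [subst, Forces, ih]
  | box α ih => simp only [subst, Forces, ih]

theorem forces_of_mem_formulas {Var W : Type*} [PartialOrder W] {V : Var → Set W}
    (hV : ∀ x, IsUpperSet (V x)) (a b c : Form Var) {g : AxiomGroup} {α : Form Var}
    (h : α ∈ g.formulas a b c) (w : W) : Forces V w α := by
  have mono : ∀ {β : Form Var} {u v : W}, u ≤ v → Forces V u β → Forces V v β :=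
    fun h => Forces.mono hV h
  cases g with
  | i =>
    rcases h with rfl | rfl
    · exact fun v _ ha u hu _ => mono hu ha
    · exact fun v _ h₁ u hu h₂ t ht ha => h₁ t (hu.trans ht) ha t le_rfl (h₂ t ht ha)
  | c =>
    rcases h with rfl | rfl | rfl
    · exact fun v _ h => h.1
    · exact fun v _ h => h.2
    · exact fun v _ ha u hu hb => ⟨mono hu ha, hb⟩
  | d =>
    rcases h with rfl | rfl | rfl
    · exact fun v _ h => Or.inl h
    · exact fun v _ h => Or.inr h
    · exact fun v _ h₁ u hu h₂ t ht h => h.elim (h₁ t (hu.trans ht)) (h₂ t ht)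
  | n =>
    rcases h with rfl | rfl
    · exact fun v _ h₁ u hu h₂ t ht ha => h₂ t ht ha t le_rfl (h₁ t (hu.trans ht) ha)
    · exact fun v _ ha u hu hna => (hna u le_rfl (mono hu ha)).elim
  | m =>
    rcases h with rfl | rfl | rfl
    · exact fun v _ h₁ u hu h₂ t ht => h₁ t (hu.trans_lt ht) t le_rfl (h₂ t ht)
    · exact fun v _ ha u hu => mono hu.le ha
    · intro v _ hbox u hu h
      -- If `b` fails at `u`, every `t ≥ u` forcing `b` lies strictly above `u` (by antisymmetry),
      -- so `□a` gives `a` there; hence `b ⇒ a` holds at `u`.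
      by_contra hb
      refine hb (h u le_rfl fun t ht hbt => hbox t (hu.trans_lt (ht.lt_of_ne ?_)))
      rintro rfl
      exact hb hbt

end Form

/-! ### Soundness and axiom instances -/

namespace Derivable

variable {Var : Type*}

theorem mono {Ax Ax' : Set (Form Var)} (h : Ax ⊆ Ax') {α : Form Var} (hα : Derivable Ax α) :
    Derivable Ax' α := by
  induction hα with
  | ax hα => exact .ax (h hα)
  | mp _ _ ih₁ ih₂ => exact .mp ih₁ ih₂
  | sub s _ ih => exact .sub s ih

/-- Soundness for Kripke models over partial orders. -/
theorem forces {W : Type*} [PartialOrder W] {p q r : Var} {G : Set AxiomGroup} {α : Form Var}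
    (h : Derivable (axiomsOf p q r G) α) {V : Var → Set W} (hV : ∀ x, IsUpperSet (V x)) (w : W) :
    α.Forces V w := by
  induction h generalizing V w with
  | ax hα =>
    obtain ⟨g, _, hg⟩ := hα
    exact Form.forces_of_mem_formulas hV _ _ _ hg w
  | mp _ _ ih₁ ih₂ => exact ih₁ hV w w le_rfl (ih₂ hV w)
  | sub s _ ih =>
    -- Substitution becomes a change of valuation, still upward closed by persistence.
    exact (Form.forces_subst V s _ w).2
      (ih (V := fun x => {v | (s x).Forces V v})
        (fun _ _ _ hle h => Form.Forces.mono hV hle h) w)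

/-- Distinctness of `p`, `q`, `r` lets one substitution send them to arbitrary `a`, `b`, `c`. -/
theorem of_mem_formulas {p q r : Var} (hpq : p ≠ q) (hpr : p ≠ r) (hqr : q ≠ r)
    {G : Set AxiomGroup} {g : AxiomGroup} (hg : g ∈ G) (a b c : Form Var) {α : Form Var}
    (hα : α ∈ g.formulas a b c) : Derivable (axiomsOf p q r G) α := by
  classical
  let s : Var → Form Var := fun x => if x = p then a else if x = q then b else c
  have hp : s p = a := if_pos rfl
  have hq : s q = b := by simp [s, hpq.symm]
  have hr : s r = c := by simp [s, hpr.symm, hqr.symm]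
  obtain ⟨β, hβ, rfl⟩ : ∃ β ∈ g.formulas (.var p) (.var q) (.var r), β.subst s = α := by
    cases g <;>
      simpa [AxiomGroup.formulas, Form.subst, hp, hq, hr, eq_comm] using hα
  exact .sub s (.ax ⟨g, hg, hβ⟩)

end Derivable

/-! ### Theories and relative maximality -/

/-- A set of formulas that contains the formulas derivable from `Ax` and is closed under modus
ponens. -/
structure IsTheory {Var : Type*} (Ax T : Set (Form Var)) : Prop where
  of_derivable : ∀ {α}, Derivable Ax α → α ∈ T
  mp : ∀ {α β}, (α ⇒ β) ∈ T → α ∈ T → β ∈ T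

/-- The theories that are maximal among those omitting some formula. -/
def IsRelMaximal {Var : Type*} (Ax T : Set (Form Var)) : Prop :=
  ∃ φ, Maximal (fun S => IsTheory Ax S ∧ φ ∉ S) T

namespace IsTheory

variable {Var : Type*} {Ax T : Set (Form Var)}

theorem derivable : IsTheory Ax {α | Derivable Ax α} := ⟨id, .mp⟩

/-- Lindenbaum's lemma. -/
theorem exists_isRelMaximal (hT : IsTheory Ax T) {φ : Form Var} (hφ : φ ∉ T) :
    ∃ S, T ⊆ S ∧ φ ∉ S ∧ IsRelMaximal Ax S := by
  obtain ⟨S, hTS, hS⟩ := zorn_subset_nonempty {S | IsTheory Ax S ∧ φ ∉ S} (by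
    intro C hC hchain hne
    refine ⟨⋃₀ C, ⟨⟨?_, ?_⟩, ?_⟩, fun S hS => Set.subset_sUnion_of_mem hS⟩
    · intro α hα
      obtain ⟨S, hS⟩ := hne
      exact ⟨S, hS, (hC hS).1.of_derivable hα⟩
    · rintro α β ⟨S, hS, hαβ⟩ ⟨S', hS', hα⟩
      rcases hchain.total hS hS' with h | h
      · exact ⟨S', hS', (hC hS').1.mp (h hαβ) hα⟩
      · exact ⟨S, hS, (hC hS).1.mp hαβ (h hα)⟩
    · rintro ⟨S, hS, h⟩
      exact (hC hS).2 h) T ⟨hT, hφ⟩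
  exact ⟨S, hTS, hS.prop.2, φ, hS⟩

section Fragment

variable {p q r : Var} {G : Set AxiomGroup}

theorem mem_of_mem_formulas (hT : IsTheory (axiomsOf p q r G) T)
    (hpq : p ≠ q) (hpr : p ≠ r) (hqr : q ≠ r) {g : AxiomGroup} (hg : g ∈ G)
    (a b c : Form Var) {α : Form Var} (hα : α ∈ g.formulas a b c) : α ∈ T :=
  hT.of_derivable (.of_mem_formulas hpq hpr hqr hg a b c hα)

theorem imp_self_mem (hT : IsTheory (axiomsOf p q r G) T)
    (hpq : p ≠ q) (hpr : p ≠ r) (hqr : q ≠ r) (hi : .i ∈ G) (α : Form Var) : (α ⇒ α) ∈ T := by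
  have ax := hT.mem_of_mem_formulas hpq hpr hqr hi
  exact hT.mp (hT.mp (ax α (α ⇒ α) α (.inr rfl)) (ax α (α ⇒ α) α (.inl rfl)))
    (ax α α α (.inl rfl))

/-- The deduction theorem: the formulas implied by `α` form a theory. -/
theorem adjoin (hT : IsTheory (axiomsOf p q r G) T)
    (hpq : p ≠ q) (hpr : p ≠ r) (hqr : q ≠ r) (hi : .i ∈ G) (α : Form Var) :
    IsTheory (axiomsOf p q r G) {β | (α ⇒ β) ∈ T} where
  of_derivable {β} hβ :=
    hT.mp (hT.mem_of_mem_formulas hpq hpr hqr hi β α β (.inl rfl)) (hT.of_derivable hβ)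
  mp {β γ} h₁ h₂ :=
    hT.mp (hT.mp (hT.mem_of_mem_formulas hpq hpr hqr hi α β γ (.inr rfl)) h₁) h₂

theorem subset_adjoin (hT : IsTheory (axiomsOf p q r G) T)
    (hpq : p ≠ q) (hpr : p ≠ r) (hqr : q ≠ r) (hi : .i ∈ G) (α : Form Var) :
    T ⊆ {β | (α ⇒ β) ∈ T} := fun β hβ =>
  hT.mp (hT.mem_of_mem_formulas hpq hpr hqr hi β α β (.inl rfl)) hβ

theorem exists_isRelMaximal_of_imp_notMem (hT : IsTheory (axiomsOf p q r G) T)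
    (hpq : p ≠ q) (hpr : p ≠ r) (hqr : q ≠ r) (hi : .i ∈ G) {α β : Form Var}
    (h : (α ⇒ β) ∉ T) :
    ∃ S, T ⊆ S ∧ α ∈ S ∧ β ∉ S ∧ IsRelMaximal (axiomsOf p q r G) S := by
  obtain ⟨S, hS, hβ, hmax⟩ :=
    (hT.adjoin hpq hpr hqr hi α).exists_isRelMaximal (φ := β) h
  exact ⟨S, (hT.subset_adjoin hpq hpr hqr hi α).trans hS,
    hS (hT.imp_self_mem hpq hpr hqr hi α), hβ, hmax⟩

end Fragment

end IsTheory

namespace IsRelMaximal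

variable {Var : Type*} {p q r : Var} {G : Set AxiomGroup} {T : Set (Form Var)}

theorem isTheory {Ax : Set (Form Var)} (hT : IsRelMaximal Ax T) : IsTheory Ax T :=
  hT.choose_spec.prop.1

/-- By maximality every formula outside `T` implies the omitted `φ`; were both disjuncts outside,
case analysis would put `φ` in `T`. -/
theorem mem_or_mem (hT : IsRelMaximal (axiomsOf p q r G) T)
    (hpq : p ≠ q) (hpr : p ≠ r) (hqr : q ≠ r) (hi : .i ∈ G) (hd : .d ∈ G) {α β : Form Var}
    (h : (α ⋎ β) ∈ T) : α ∈ T ∨ β ∈ T := by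
  obtain ⟨φ, hmax⟩ := hT
  have hth := hmax.prop.1
  have key : ∀ γ, γ ∉ T → (γ ⇒ φ) ∈ T := by
    intro γ hγ
    by_contra hγφ
    exact hγ (hmax.2 ⟨hth.adjoin hpq hpr hqr hi γ, hγφ⟩ (hth.subset_adjoin hpq hpr hqr hi γ)
      (hth.imp_self_mem hpq hpr hqr hi γ))
  by_contra! hne
  exact hmax.prop.2 (hth.mp (hth.mp (hth.mp
    (hth.mem_of_mem_formulas hpq hpr hqr hd α β φ (.inr (.inr rfl))) (key α hne.1))
    (key β hne.2)) h)

theorem notMem_of_neg_mem (hT : IsRelMaximal (axiomsOf p q r G) T)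
    (hpq : p ≠ q) (hpr : p ≠ r) (hqr : q ≠ r) (hn : .n ∈ G) {α : Form Var}
    (h : ∼α ∈ T) : α ∉ T := by
  obtain ⟨φ, hmax⟩ := hT
  have hth := hmax.prop.1
  exact fun hα => hmax.prop.2 (hth.mp (hth.mp
    (hth.mem_of_mem_formulas hpq hpr hqr hn α φ φ (.inr rfl)) hα) h)

end IsRelMaximal

/-! ### Canonical model and separation -/

/-- The truth lemma for the canonical model of a fragment. -/
theorem forces_canonical_iff {Var : Type*} {p q r : Var} (hpq : p ≠ q) (hpr : p ≠ r)
    (hqr : q ≠ r) {G : Set AxiomGroup} (hi : .i ∈ G) {α : Form Var} (hα : α.IsAssertoric)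
    (hG : ∀ k ∈ α.connectives, k.group ∈ G)
    (T : {T : Set (Form Var) // IsRelMaximal (axiomsOf p q r G) T}) :
    α.Forces (fun x => {S : {T // IsRelMaximal (axiomsOf p q r G) T} | Form.var x ∈ S.1}) T ↔
      α ∈ T.1 := by
  have ax (S : {T : Set (Form Var) // IsRelMaximal (axiomsOf p q r G) T}) {g : AxiomGroup}
      (hg : g ∈ G) := S.2.isTheory.mem_of_mem_formulas hpq hpr hqr hg
  have mp (S : {T : Set (Form Var) // IsRelMaximal (axiomsOf p q r G) T}) {β γ : Form Var} :=
    S.2.isTheory.mp (α := β) (β := γ)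
  induction α generalizing T with
  | var x => rfl
  | conj α β ihα ihβ =>
    have ihα' := ihα (fun h => hα (.inr (.inl h))) (fun k h => hG k (.inr (.inl h))) T
    have ihβ' := ihβ (fun h => hα (.inr (.inr h))) (fun k h => hG k (.inr (.inr h))) T
    simp only [Form.Forces, ihα', ihβ']
    have hc : AxiomGroup.c ∈ G := hG .conj (.inl rfl)
    exact ⟨fun h => mp T (mp T (ax T hc α β α (.inr (.inr rfl))) h.1) h.2,
      fun h => ⟨mp T (ax T hc α β α (.inl rfl)) h, mp T (ax T hc α β α (.inr (.inl rfl))) h⟩⟩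
  | disj α β ihα ihβ =>
    have ihα' := ihα (fun h => hα (.inr (.inl h))) (fun k h => hG k (.inr (.inl h))) T
    have ihβ' := ihβ (fun h => hα (.inr (.inr h))) (fun k h => hG k (.inr (.inr h))) T
    simp only [Form.Forces, ihα', ihβ']
    have hd : AxiomGroup.d ∈ G := hG .disj (.inl rfl)
    refine ⟨?_, T.2.mem_or_mem hpq hpr hqr hi hd⟩
    rintro (h | h)
    · exact mp T (ax T hd α β α (.inl rfl)) h
    · exact mp T (ax T hd β α α (.inr (.inl rfl))) h
  | imp α β ihα ihβ =>
    have ihα' S := ihα (fun h => hα (.inr (.inl h))) (fun k h => hG k (.inr (.inl h))) S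
    have ihβ' S := ihβ (fun h => hα (.inr (.inr h))) (fun k h => hG k (.inr (.inr h))) S
    simp only [Form.Forces, ihα', ihβ']
    refine ⟨fun h => ?_, fun h S hS hαS => S.2.isTheory.mp (hS h) hαS⟩
    by_contra hT
    obtain ⟨S, hTS, hαS, hβS, hS⟩ :=
      T.2.isTheory.exists_isRelMaximal_of_imp_notMem hpq hpr hqr hi hT
    exact hβS (h ⟨S, hS⟩ hTS hαS)
  | neg α ih =>
    have ih' S := ih (fun h => hα (.inr h)) (fun k h => hG k (.inr h)) S
    have hn : AxiomGroup.n ∈ G := hG .neg (.inl rfl)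
    simp only [Form.Forces, ih']
    refine ⟨fun h => ?_, fun h S hS => S.2.notMem_of_neg_mem hpq hpr hqr hn (hS h)⟩
    by_contra hT
    -- Reductio applied to `α ⇒ α` and `α ⇒ ∼α` would yield `∼α`.
    have hT' : (α ⇒ ∼α) ∉ T.1 := fun hc => hT (mp T (mp T (ax T hn α α α (.inl rfl))
      (T.2.isTheory.imp_self_mem hpq hpr hqr hi α)) hc)
    obtain ⟨S, hTS, hαS, _, hS⟩ :=
      T.2.isTheory.exists_isRelMaximal_of_imp_notMem hpq hpr hqr hi hT'
    exact h ⟨S, hS⟩ hTS hαS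
  | box α _ => exact (hα (.inl rfl)).elim

theorem mainTheorem7 {Var : Type*} [Countable Var] (p q r : Var)
    (hpq : p ≠ q) (hpr : p ≠ r) (hqr : q ≠ r) (A : Form Var) (hA : A.IsAssertoric) :
    DerivableE p q r A ↔ Derivable (axiomsOf p q r (relevantGroups A)) A := by
  refine ⟨fun h => ?_, fun h => h.mono ?_⟩
  swap
  · rintro α ⟨g, _, hg⟩
    exact ⟨g, trivial, hg⟩
  by_contra hnot
  obtain ⟨T, _, hAT, hT⟩ := IsTheory.derivable.exists_isRelMaximal hnot
  refine hAT ((forces_canonical_iff hpq hpr hqr (.inl rfl) hA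
    (fun k hk => .inr ⟨k, hk, rfl⟩) ⟨T, hT⟩).1 (h.forces ?_ _))
  intro x S S' hle hx
  exact Subtype.coe_le_coe.2 hle hx
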